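/- Let $\mathbb{S}=\{I\in\mathbb{H}: I^2=-1\}$. A \emph{symmetric slice domain} is a nonempty connected open set $\Omega\subseteq\mathbb{H}$ that meets $\mathbb{R}$, such that $\Omega_I=\Omega\cap(\mathbb{R}+I\mathbb{R})$ is connected for every $I\in\mathbb{S}$, and that contains the whole sphere $x+y\mathbb{S}=\{x+yJ:J\in\mathbb{S}\}$ whenever it contains a point $x+yI$ with $x,y\in\mathbb{R}$, $I\in\mathbb{S}$. A function $f$ is \emph{(slice) regular} on an open set $\Omega$ if for every $I\in\mathbb{S}$ its restriction $f_I$ to $\Omega_I$ is $C^1$ and $\frac12\left(\frac{\partial}{\partial x}+I\frac{\partial}{\partial y}\right)f_I(x+Iy)=0$ on $\Omega_I$. For $p\in\mathbb{H}$ and $n\in\mathbb{N}$ let $(q-p)^{*n}=\sum_{k=0}^n q^k\binom nk(-p)^{n-k}$ be the $n$-th power of $q-p$ for the product $\left(\sum_k q^ka_k\right)*\left(\sum_k q^kb_k\right)=\sum_k q^k\sum_{j\le k}a_jb_{k-j}$. For $m>0$ let $(q-p)^{*(-m)}$ be the regular reciprocal of $P=(q-p)^{*m}$, that is $(P*P^c)(q)^{-1}P^c(q)$,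 where $P^c$ is obtained from $P=\sum_k q^ka_k$ by conjugating all the coefficients $a_k$; it is defined off the zero set of $P*P^c$, which is the sphere through $p$. For $q,p\in\mathbb{H}$ put $\sigma(q,p)=\tau(q,p)=|q-p|$ if $q,p$ lie on a common line $\mathbb{R}+I\mathbb{R}$, and otherwise $$\sigma(q,p)=\sqrt{(\operatorname{Re}q-\operatorname{Re}p)^2+(|\operatorname{Im}q|+|\operatorname{Im}p|)^2},\qquad \tau(q,p)=\sqrt{(\operatorname{Re}q-\operatorname{Re}p)^2+(|\operatorname{Im}q|-|\operatorname{Im}p|)^2}.$$ Let $\Sigma(p,0,R)=\{q:\tau(q,p)>0,\ \sigma(q,p)<R\}$. (For small $R$ this set does not meet the sphere through $p$.) Let $f$ be regular on a symmetric slice domain $\Omega'$. A point $p\in\mathbb{H}$ is a \emph{singularity} of $f$ if $\Sigma(p,0,R)\subseteq\Omega'$ for some $R>0$. It is a \emph{pole} if moreover, for some such $R$, there are $a_n\in\mathbb{H}$ $(n\in\mathbb{Z})$ with $f(q)=\sum_{n\in\mathbb{Z}}(q-p)^{*n}a_n$ on $\Sigma(p,0,R)$, and an $m\ge0$ such that $a_{-k}=0$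 for all $k>m$; the least such $m$ is the \emph{order} $\operatorname{ord}_f(p)$. (Poles of order $0$ are allowed; in particular every point of $\Omega'$ is one.) A singularity $p$ is \emph{removable} if $f$ extends to a neighborhood of $p$ as a regular function. The function $f$ is \emph{semiregular} in a symmetric slice domain $\Omega\supseteq\Omega'$ if every point of $\Omega\setminus\Omega'$ is a pole or a removable singularity of $f$. \textbf{Theorem (Structure of the poles).} Let $\Omega$ be a symmetric slice domain and let $f$ be semiregular in $\Omega$. Let $x,y\in\mathbb{R}$ be such that $x+y\mathbb{S}\subset\Omega$. Then every point of $x+y\mathbb{S}$ is a pole of $f$ (possibly of order $0$), and there is an $n\in\mathbb{N}$ such that either $\operatorname{ord}_f(p)=n$ for all $p\in x+y\mathbb{S}$, or there is exactly one exceptional point $p_0\in x+y\mathbb{S}$: $\operatorname{ord}_f(p_0)<n$, and $\operatorname{ord}_f(p)=n$ for all $p\in x+y\mathbb{S}$ with $p\neq p_0$. -/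

import Mathlib

open scoped Quaternion

noncomputable section

namespace SliceRegular

/-- The 2-sphere `𝕊` of quaternionic imaginary units. -/
def imaginaryUnits : Set ℍ[ℝ] := {I | I ^ 2 = -1}

/-- The point `x + y I`. -/
def slicePoint (I : ℍ[ℝ]) (x y : ℝ) : ℍ[ℝ] := (x : ℍ[ℝ]) + (y : ℍ[ℝ]) * I

/-- The complex line `ℝ + I ℝ`. -/
def complexLine (I : ℍ[ℝ]) : Set ℍ[ℝ] := {q | ∃ x y : ℝ, q = slicePoint I x y}

/-- The sphere `x + y 𝕊` (a single point if `y = 0`). -/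
def sphere (x y : ℝ) : Set ℍ[ℝ] := {q | ∃ I ∈ imaginaryUnits, q = slicePoint I x y}

/-- A domain: a nonempty connected open set. -/
def IsDomainSet (Ω : Set ℍ[ℝ]) : Prop := IsOpen Ω ∧ IsConnected Ω

/-- Slice domains. Each `Ω ∩ (ℝ + I ℝ)` is automatically open in `ℝ + I ℝ`, since `Ω` is open. -/
structure IsSliceDomain (Ω : Set ℍ[ℝ]) : Prop where
  isDomainSet : IsDomainSet Ω
  meets_real : ∃ r : ℝ, (r : ℍ[ℝ]) ∈ Ω
  slice_connected : ∀ I ∈ imaginaryUnits, IsConnected (Ω ∩ complexLine I)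

/-- Axially symmetric sets. -/
def IsAxiallySymmetric (T : Set ℍ[ℝ]) : Prop :=
  ∀ x y : ℝ, ∀ I ∈ imaginaryUnits, slicePoint I x y ∈ T → sphere x y ⊆ T

/-- Symmetric slice domains. -/
def IsSymmetricSliceDomain (Ω : Set ℍ[ℝ]) : Prop :=
  IsSliceDomain Ω ∧ IsAxiallySymmetric Ω

/-- `f` is slice regular on the open set `Ω`: for every imaginary unit `I` the restriction `f_I` to
`Ω ∩ (ℝ + I ℝ)` is `C¹` and satisfies `(1/2) (∂/∂x + I ∂/∂y) f_I (x + I y) = 0`.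
Values of `f` outside `Ω` are irrelevant. -/
def IsSliceRegularOn (f : ℍ[ℝ] → ℍ[ℝ]) (Ω : Set ℍ[ℝ]) : Prop :=
  ∀ I ∈ imaginaryUnits,
    ContDiffOn ℝ 1 (fun v : ℝ × ℝ => f (slicePoint I v.1 v.2)) {v | slicePoint I v.1 v.2 ∈ Ω} ∧
    ∀ v : ℝ × ℝ, slicePoint I v.1 v.2 ∈ Ω →
      (1 / 2 : ℝ) • (fderiv ℝ (fun w : ℝ × ℝ => f (slicePoint I w.1 w.2)) v (1, 0)
        + I * fderiv ℝ (fun w : ℝ × ℝ => f (slicePoint I w.1 w.2)) v (0, 1)) = 0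

/-! Regular polynomials `∑ qⁿ aₙ`: the `*`-product of two of them is the product of the polynomial
ring over the quaternions, whose variable commutes with the coefficients. -/

/-- The value `∑ qⁿ aₙ` at `q` (coefficients on the right) of the polynomial with coefficients
`aₙ`. -/
def evalRight (P : Polynomial ℍ[ℝ]) (q : ℍ[ℝ]) : ℍ[ℝ] := P.sum fun n a => q ^ n * a

/-- The regular conjugate `Pᶜ = ∑ qⁿ (conjugate of aₙ)`. -/
def regConj (P : Polynomial ℍ[ℝ]) : Polynomial ℍ[ℝ] :=
  P.sum fun n a => Polynomial.monomial n (star a)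

/-- The symmetrization `Pˢ = P * Pᶜ`. -/
def symmetrization (P : Polynomial ℍ[ℝ]) : Polynomial ℍ[ℝ] := P * regConj P

/-- The regular reciprocal `P^{-*} = (Pˢ)⁻¹ Pᶜ`, meaningful off the zero set of `Pˢ`. -/
def regReciprocal (P : Polynomial ℍ[ℝ]) (q : ℍ[ℝ]) : ℍ[ℝ] :=
  (evalRight (symmetrization P) q)⁻¹ * evalRight (regConj P) q

/-- The `*`-powers `(q - p)^{*n}`, `n ∈ ℤ`; for `n = -m < 0` this is the regular reciprocal of
`(q - p)^{*m}`. -/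
def starPow (p : ℍ[ℝ]) : ℤ → ℍ[ℝ] → ℍ[ℝ]
  | Int.ofNat n, q => evalRight ((Polynomial.X - Polynomial.C p) ^ n) q
  | Int.negSucc n, q => regReciprocal ((Polynomial.X - Polynomial.C p) ^ (n + 1)) q

/-- `p` and `q` lie on a common complex line `ℝ + I ℝ`. -/
def OnSameLine (q p : ℍ[ℝ]) : Prop :=
  ∃ I ∈ imaginaryUnits, q ∈ complexLine I ∧ p ∈ complexLine I

open Classical in
/-- The distance `σ`. -/
def sigmaDist (q p : ℍ[ℝ]) : ℝ :=
  if OnSameLine q p then ‖q - p‖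
  else Real.sqrt ((q.re - p.re) ^ 2 + (‖q.im‖ + ‖p.im‖) ^ 2)

open Classical in
/-- The function `τ`. -/
def tauDist (q p : ℍ[ℝ]) : ℝ :=
  if OnSameLine q p then ‖q - p‖
  else Real.sqrt ((q.re - p.re) ^ 2 + (‖q.im‖ - ‖p.im‖) ^ 2)

/-- The set `Σ(p, R₁, R₂)`. -/
def sigmaAnnulus (p : ℍ[ℝ]) (R₁ R₂ : ℝ) : Set ℍ[ℝ] :=
  {q | R₁ < tauDist q p ∧ sigmaDist q p < R₂}

/-- `p` is a singularity for a regular function with domain `D`. -/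
def IsSingularity (D : Set ℍ[ℝ]) (p : ℍ[ℝ]) : Prop :=
  ∃ R : ℝ, 0 < R ∧ sigmaAnnulus p 0 R ⊆ D

/-- `∑ (q - p)^{*n} aₙ` (over `n ∈ ℤ`) is the Laurent expansion at the singularity `p` of `f`, a
function with domain `D`. -/
def IsLaurentExpansionAt (f : ℍ[ℝ] → ℍ[ℝ]) (D : Set ℍ[ℝ]) (p : ℍ[ℝ]) (a : ℤ → ℍ[ℝ]) : Prop :=
  ∃ R : ℝ, 0 < R ∧ sigmaAnnulus p 0 R ⊆ D ∧
    ∀ q ∈ sigmaAnnulus p 0 R, HasSum (fun n : ℤ => starPow p n q * a n) (f q)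

/-- The `m ∈ ℕ` such that the Laurent coefficients of `f` at `p` satisfy `a₋ₖ = 0` for all
`k > m`. -/
def poleBounds (f : ℍ[ℝ] → ℍ[ℝ]) (D : Set ℍ[ℝ]) (p : ℍ[ℝ]) : Set ℕ :=
  {m | ∃ a : ℤ → ℍ[ℝ], IsLaurentExpansionAt f D p a ∧ ∀ k : ℕ, m < k → a (-(k : ℤ)) = 0}

/-- `p` is a pole (possibly of order `0`) for `f`, a function with domain `D`. -/
def IsPole (f : ℍ[ℝ] → ℍ[ℝ]) (D : Set ℍ[ℝ]) (p : ℍ[ℝ]) : Prop := (poleBounds f D p).Nonempty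

/-- The order `ord_f(p)`: the least `m ≥ 0` with `a₋ₖ = 0` for all `k > m` if `p` is a pole, and
`+∞` otherwise. -/
def poleOrder (f : ℍ[ℝ] → ℍ[ℝ]) (D : Set ℍ[ℝ]) (p : ℍ[ℝ]) : ℕ∞ :=
  ⨅ m ∈ poleBounds f D p, (m : ℕ∞)

/-- `p` is a removable singularity for `f`, a function with domain `D`: `f` extends to a
neighborhood of `p` as a regular function. -/
def IsRemovable (f : ℍ[ℝ] → ℍ[ℝ]) (D : Set ℍ[ℝ]) (p : ℍ[ℝ]) : Prop :=
  IsSingularity D p ∧ ∃ U : Set ℍ[ℝ], IsOpen U ∧ p ∈ U ∧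
    ∃ g : ℍ[ℝ] → ℍ[ℝ], IsSliceRegularOn g U ∧ Set.EqOn g f (U ∩ D)

/-- The function `f`, with domain `D`, is semiregular in `Ω`. -/
structure IsSemiregular (f : ℍ[ℝ] → ℍ[ℝ]) (D Ω : Set ℍ[ℝ]) : Prop where
  subset : D ⊆ Ω
  domain : IsSymmetricSliceDomain D
  regular : IsSliceRegularOn f D
  pole_or_removable : ∀ p ∈ Ω \ D, IsPole f D p ∨ IsRemovable f D p

end SliceRegular

end

open Filter Topology Asymptotics

namespace SliceRegular

/-! On a single complex line the statement is classical complex analysis. A regular f restricts to a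
function holomorphic for left multiplication by J; for non-real p = x + yJ a small Σ(p,0,R) is a
punctured disc of ℝ + Jℝ, on which (q - p)^{*n} becomes (z - w)^n with w = x + iy. By Riemann's
removable singularity theorem, a singularity p has order at most m exactly when |z - w|^m |f| is
bounded near w on that line (`weightBounded_of_mem_poleBounds`, `mem_poleBounds_of_weightBounded`).

The lines are linked by the representation formula: for fixed x, y the value f(x + yM) is affine in
M. Two units J ≠ K therefore determine the value at any L, through the factor (L - J)(K - J)⁻¹,
which does not depend on x, y. Growth bounds at two points of a sphere pass to all its points
(`WeightBounded.of_two`), so the points of order at most m form the empty set, a single point or the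
whole sphere. Hence at most one point has smaller order.

For y = 0 the sphere is one real point, and only the existence of a pole is at stake: where f
extends regularly, the power series on the various lines share their coefficients. -/

/-! ### Imaginary units and complex lines -/

theorem re_eq_zero_of_mem {I : ℍ[ℝ]} (hI : I ∈ imaginaryUnits) : I.re = 0 := by
  have h : I * I = -1 := by rw [← sq]; exact hI
  have h0 := congrArg (fun q : ℍ[ℝ] => q.re) h
  have h1 := congrArg (fun q : ℍ[ℝ] => q.imI) h
  have h2 := congrArg (fun q : ℍ[ℝ] => q.imJ) h
  have h3 := congrArg (fun q : ℍ[ℝ] => q.imK) h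
  simp at h0 h1 h2 h3
  by_contra hr
  have e1 : I.imI = 0 := by
    have : I.re * I.imI = 0 := by linarith
    simpa [hr] using this
  have e2 : I.imJ = 0 := by
    have : I.re * I.imJ = 0 := by linarith
    simpa [hr] using this
  have e3 : I.imK = 0 := by
    have : I.re * I.imK = 0 := by linarith
    simpa [hr] using this
  rw [e1, e2, e3] at h0
  nlinarith [sq_nonneg I.re]

theorem mul_self_of_mem {I : ℍ[ℝ]} (hI : I ∈ imaginaryUnits) : I * I = -1 := by
  rw [← sq]; exact hI

theorem neg_mem_imaginaryUnits {I : ℍ[ℝ]} (hI : I ∈ imaginaryUnits) : -I ∈ imaginaryUnits := by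
  change (-I) ^ 2 = -1
  rw [neg_sq]; exact hI

theorem norm_of_mem {I : ℍ[ℝ]} (hI : I ∈ imaginaryUnits) : ‖I‖ = 1 := by
  have h : ‖I‖ * ‖I‖ = 1 := by rw [← norm_mul, mul_self_of_mem hI]; simp
  nlinarith [norm_nonneg I]

/-- The embedding of `ℂ` onto the complex line `ℝ + I ℝ`. -/
noncomputable def sliceHom (I : ℍ[ℝ]) (hI : I ∈ imaginaryUnits) : ℂ →ₐ[ℝ] ℍ[ℝ] :=
  Complex.liftAux I (mul_self_of_mem hI)

theorem sliceHom_apply {I : ℍ[ℝ]} (hI : I ∈ imaginaryUnits) (z : ℂ) :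
    sliceHom I hI z = slicePoint I z.re z.im := by
  rw [sliceHom, Complex.liftAux_apply, slicePoint, Quaternion.coe_mul_eq_smul]
  rfl

theorem re_slicePoint {I : ℍ[ℝ]} (hI : I ∈ imaginaryUnits) (x y : ℝ) :
    (slicePoint I x y).re = x := by
  simp [slicePoint, re_eq_zero_of_mem hI]

theorem im_slicePoint {I : ℍ[ℝ]} (hI : I ∈ imaginaryUnits) (x y : ℝ) :
    (slicePoint I x y).im = (y : ℍ[ℝ]) * I := by
  have := re_eq_zero_of_mem hI
  ext <;> simp [slicePoint, this]

theorem star_sliceHom {I : ℍ[ℝ]} (hI : I ∈ imaginaryUnits) (z : ℂ) :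
    star (sliceHom I hI z) = sliceHom I hI (star z) := by
  have := re_eq_zero_of_mem hI
  rw [sliceHom_apply, sliceHom_apply]
  ext <;> simp [slicePoint, this, mul_comm]

theorem norm_sliceHom {I : ℍ[ℝ]} (hI : I ∈ imaginaryUnits) (z : ℂ) :
    ‖sliceHom I hI z‖ = ‖z‖ := by
  have h' : ‖sliceHom I hI z‖ ^ 2 = ‖z‖ ^ 2 := by
    have h : ‖sliceHom I hI z‖ ^ 2 = ‖sliceHom I hI z * star (sliceHom I hI z)‖ := by
      rw [norm_mul, norm_star, sq]
    rw [h, star_sliceHom, ← map_mul, ← starRingEnd_apply, Complex.mul_conj, sliceHom_apply,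
      Complex.normSq_eq_norm_sq]
    simp [slicePoint, -Complex.ofReal_pow]
  exact (pow_left_inj₀ (norm_nonneg _) (norm_nonneg _) two_ne_zero).1 h'

theorem continuous_sliceHom {I : ℍ[ℝ]} (hI : I ∈ imaginaryUnits) :
    Continuous (sliceHom I hI) :=
  (AddMonoidHomClass.isometry_of_norm (sliceHom I hI) (norm_sliceHom hI)).continuous

/-! ### Regularity as holomorphy on each complex line -/

/-- The complex structure on the quaternions given by left multiplication by `I`. -/
@[reducible] noncomputable def sliceNormedSpace (I : ℍ[ℝ]) (hI : I ∈ imaginaryUnits) :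
    NormedSpace ℂ ℍ[ℝ] :=
  { Module.compHom ℍ[ℝ] (sliceHom I hI).toRingHom with
    norm_smul_le := fun z q => by
      change ‖sliceHom I hI z * q‖ ≤ _
      rw [norm_mul, norm_sliceHom] }

/-- `u` is complex differentiable at `z`, for the complex structure given by `I`. -/
def SliceDiffAt (I : ℍ[ℝ]) (hI : I ∈ imaginaryUnits) (u : ℂ → ℍ[ℝ]) (z : ℂ) : Prop :=
  ∃ c : ℍ[ℝ], (fun w => u w - u z - sliceHom I hI (w - z) * c) =o[𝓝 z] fun w => w - z

/-- `SliceDiffAt` involves no instance, so different units can occur in one statement; here it is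
traded for complex differentiability. -/
theorem sliceDiffAt_iff {I : ℍ[ℝ]} (hI : I ∈ imaginaryUnits) (u : ℂ → ℍ[ℝ]) (z : ℂ) :
    SliceDiffAt I hI u z ↔
      let _ := sliceNormedSpace I hI
      DifferentiableAt ℂ u z := by
  let _ := sliceNormedSpace I hI
  constructor
  · rintro ⟨c, hc⟩
    exact (hasDerivAt_iff_isLittleO.2 hc : HasDerivAt u c z).differentiableAt
  · intro h
    exact ⟨deriv u z, hasDerivAt_iff_isLittleO.1 h.hasDerivAt⟩

theorem SliceDiffAt.add {I : ℍ[ℝ]} {hI : I ∈ imaginaryUnits} {u v : ℂ → ℍ[ℝ]} {z : ℂ}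
    (hu : SliceDiffAt I hI u z) (hv : SliceDiffAt I hI v z) :
    SliceDiffAt I hI (fun w => u w + v w) z := by
  obtain ⟨c, hc⟩ := hu
  obtain ⟨d, hd⟩ := hv
  refine ⟨c + d, (hc.add hd).congr_left fun w => ?_⟩
  simp only [mul_add]; abel

/-- When J a = a I, left multiplication by a is complex linear from the structure I to the structure
J. -/
theorem SliceDiffAt.intertwine {I J : ℍ[ℝ]} {hI : I ∈ imaginaryUnits} {hJ : J ∈ imaginaryUnits}
    {u : ℂ → ℍ[ℝ]} {z : ℂ} (hu : SliceDiffAt I hI u z) {a : ℍ[ℝ]} (ha : J * a = a * I) :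
    SliceDiffAt J hJ (fun w => a * u w) z := by
  obtain ⟨c, hc⟩ := hu
  have key : ∀ w, sliceHom J hJ w * a = a * sliceHom I hI w := fun w => by
    rw [sliceHom_apply, sliceHom_apply, slicePoint, slicePoint, add_mul, mul_add, mul_assoc, ha,
      ← mul_assoc, ← mul_assoc, Quaternion.coe_commutes, Quaternion.coe_commutes]
  refine ⟨a * c, (hc.const_mul_left a).congr_left fun w => ?_⟩
  rw [← mul_assoc (sliceHom J hJ _), key]
  simp only [mul_sub, mul_assoc]

theorem isOpen_slice {I : ℍ[ℝ]} (hI : I ∈ imaginaryUnits) {U : Set ℍ[ℝ]} (hU : IsOpen U) :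
    IsOpen {z | sliceHom I hI z ∈ U} :=
  hU.preimage (continuous_sliceHom hI)

/-- The Cauchy–Riemann equation says L(0,1) = I L(1,0), so the real differential L is h ↦ h ·
L(1,0). -/
theorem IsSliceRegularOn.sliceDiffAt {f : ℍ[ℝ] → ℍ[ℝ]} {U : Set ℍ[ℝ]} (hf : IsSliceRegularOn f U)
    (hU : IsOpen U) {I : ℍ[ℝ]} (hI : I ∈ imaginaryUnits) {z : ℂ} (hz : sliceHom I hI z ∈ U) :
    SliceDiffAt I hI (fun w => f (sliceHom I hI w)) z := by
  obtain ⟨h1, h2⟩ := hf I hI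
  set g : ℝ × ℝ → ℍ[ℝ] := fun v => f (slicePoint I v.1 v.2) with hg
  have hO : IsOpen {v : ℝ × ℝ | slicePoint I v.1 v.2 ∈ U} := by
    refine hU.preimage ?_
    unfold slicePoint
    have := Quaternion.continuous_coe
    fun_prop
  have hz' : slicePoint I z.re z.im ∈ U := by rwa [sliceHom_apply] at hz
  have hd : DifferentiableAt ℝ g (z.re, z.im) :=
    (h1.differentiableOn one_ne_zero).differentiableAt (hO.mem_nhds hz')
  have hcr := h2 (z.re, z.im) hz'
  set L := fderiv ℝ g (z.re, z.im) with hL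
  have hcr' : L (0, 1) = I * L (1, 0) := by
    have : L (1, 0) + I * L (0, 1) = 0 := by
      have := (smul_eq_zero.1 hcr).resolve_left (by norm_num)
      exact this
    have h3 : I * (L (1, 0) + I * L (0, 1)) = 0 := by rw [this, mul_zero]
    rw [mul_add, ← mul_assoc, mul_self_of_mem hI, neg_one_mul] at h3
    exact (sub_eq_zero.1 (by rw [sub_eq_add_neg]; exact h3)).symm
  have ho := hd.hasFDerivAt.isLittleO
  have ht : Tendsto (fun w : ℂ => (w.re, w.im)) (𝓝 z) (𝓝 (z.re, z.im)) := by
    have : Continuous (fun w : ℂ => (w.re, w.im)) := by fun_prop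
    exact this.tendsto z
  refine ⟨L (1, 0), ((ho.comp_tendsto ht).congr_left fun w => ?_).trans_isBigO ?_⟩
  · simp only [Function.comp, hg, sliceHom_apply]
    congr 1
    have : ((w.re, w.im) - (z.re, z.im) : ℝ × ℝ)
        = (w - z).re • ((1, 0) : ℝ × ℝ) + (w - z).im • ((0, 1) : ℝ × ℝ) := by
      ext <;> simp
    rw [this, map_add, map_smul, map_smul, hcr', slicePoint, add_mul, mul_assoc,
      Quaternion.coe_mul_eq_smul, Quaternion.coe_mul_eq_smul]
  · refine IsBigO.of_bound 1 (Eventually.of_forall fun w => ?_)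
    simp only [Function.comp, one_mul, Prod.norm_def]
    refine max_le ?_ ?_
    · simpa using Complex.abs_re_le_norm (w - z)
    · simpa using Complex.abs_im_le_norm (w - z)

/-! ### Slices of the domain and the representation formula -/

/-- A left inverse of `sliceHom J`: the coordinates of a quaternion along `1` and `J`. -/
theorem exists_continuous_leftInverse {J : ℍ[ℝ]} (hJ : J ∈ imaginaryUnits) :
    ∃ g : ℍ[ℝ] → ℂ, Continuous g ∧ ∀ z, g (sliceHom J hJ z) = z := by
  -- J(x + yJ) = -y + xJ, so -Re(Jq) recovers y.
  refine ⟨fun q => ⟨q.re, -(J * q).re⟩, ?_, fun z => ?_⟩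
  · have h1 : Continuous fun q : ℍ[ℝ] => q.re := Quaternion.continuous_re
    have h2 : Continuous fun q : ℍ[ℝ] => -(J * q).re :=
      (Quaternion.continuous_re.comp (continuous_const.mul continuous_id)).neg
    have : (fun q : ℍ[ℝ] => (⟨q.re, -(J * q).re⟩ : ℂ))
        = fun q => Complex.equivRealProdCLM.symm (q.re, -(J * q).re) := rfl
    rw [this]
    fun_prop
  · have h : J * sliceHom J hJ z = sliceHom J hJ (Complex.I * z) := by
      rw [map_mul, sliceHom, Complex.liftAux_apply_I]
    apply Complex.ext
    · simp only [sliceHom_apply, re_slicePoint hJ]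
    · simp only [h]
      rw [sliceHom_apply, re_slicePoint hJ]
      simp

theorem complexLine_eq_range {J : ℍ[ℝ]} (hJ : J ∈ imaginaryUnits) :
    complexLine J = Set.range (sliceHom J hJ) := by
  ext q
  constructor
  · rintro ⟨x, y, rfl⟩
    exact ⟨⟨x, y⟩, sliceHom_apply hJ _⟩
  · rintro ⟨z, rfl⟩
    exact ⟨z.re, z.im, sliceHom_apply hJ z⟩

theorem isPreconnected_slice {D : Set ℍ[ℝ]} (hD : IsSliceDomain D) {J : ℍ[ℝ]}
    (hJ : J ∈ imaginaryUnits) : IsPreconnected {z | sliceHom J hJ z ∈ D} := by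
  obtain ⟨g, hg, hgl⟩ := exists_continuous_leftInverse hJ
  have := ((hD.slice_connected J hJ).isPreconnected).image g hg.continuousOn
  convert this using 1
  ext z
  simp only [Set.mem_ofPred_eq, Set.mem_image, complexLine_eq_range hJ]
  constructor
  · exact fun h => ⟨_, ⟨h, z, rfl⟩, hgl z⟩
  · rintro ⟨_, ⟨h, w, rfl⟩, rfl⟩
    rwa [hgl]

theorem IsAxiallySymmetric.sliceHom_mem {D : Set ℍ[ℝ]} (hD : IsAxiallySymmetric D) {I J : ℍ[ℝ]}
    {hI : I ∈ imaginaryUnits} (hJ : J ∈ imaginaryUnits) {z : ℂ} (h : sliceHom I hI z ∈ D) :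
    sliceHom J hJ z ∈ D := by
  rw [sliceHom_apply] at h ⊢
  exact hD _ _ I hI h ⟨J, hJ, rfl⟩

/-- Two functions that are holomorphic for the structure `J` and agree on real points agree. -/
theorem SliceDiffAt.eqOn_of_real {J : ℍ[ℝ]} {hJ : J ∈ imaginaryUnits} {S : Set ℂ} (hS : IsOpen S)
    (hc : IsPreconnected S) {r : ℝ} (hr : (r : ℂ) ∈ S) {u v : ℂ → ℍ[ℝ]}
    (hu : ∀ z ∈ S, SliceDiffAt J hJ u z) (hv : ∀ z ∈ S, SliceDiffAt J hJ v z)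
    (huv : ∀ t : ℝ, (t : ℂ) ∈ S → u t = v t) : Set.EqOn u v S := by
  let _ := sliceNormedSpace J hJ
  have hu' : AnalyticOnNhd ℂ u S := DifferentiableOn.analyticOnNhd
    (fun z hz => ((sliceDiffAt_iff hJ u z).1 (hu z hz)).differentiableWithinAt) hS
  have hv' : AnalyticOnNhd ℂ v S := DifferentiableOn.analyticOnNhd
    (fun z hz => ((sliceDiffAt_iff hJ v z).1 (hv z hz)).differentiableWithinAt) hS
  refine hu'.eqOn_of_preconnected_of_frequently_eq hv' hc hr ?_
  -- The real points of S accumulate at r, which is enough for the identity theorem.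
  have ht : Tendsto (fun t : ℝ => (t : ℂ)) (𝓝[≠] r) (𝓝[≠] (r : ℂ)) := by
    refine tendsto_nhdsWithin_iff.2 ⟨?_, ?_⟩
    · exact (Complex.continuous_ofReal.tendsto r).mono_left nhdsWithin_le_nhds
    · filter_upwards [self_mem_nhdsWithin] with t ht
      simpa using ht
  refine ht.frequently (Eventually.frequently ?_)
  have : ∀ᶠ t : ℝ in 𝓝 r, (t : ℂ) ∈ S :=
    (Complex.continuous_ofReal.tendsto r).eventually (hS.mem_nhds hr)
  filter_upwards [this.filter_mono nhdsWithin_le_nhds] with t ht using huv t ht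

/-- The representation formula. -/
theorem IsSliceRegularOn.representation {f : ℍ[ℝ] → ℍ[ℝ]} {D : Set ℍ[ℝ]}
    (hf : IsSliceRegularOn f D) (hD : IsSymmetricSliceDomain D) {I J : ℍ[ℝ]}
    (hI : I ∈ imaginaryUnits) (hJ : J ∈ imaginaryUnits) {z : ℂ} (hz : sliceHom J hJ z ∈ D) :
    (2 : ℍ[ℝ]) * f (sliceHom J hJ z) = (1 - J * I) * f (sliceHom I hI z)
      + (1 + J * I) * f (sliceHom (-I) (neg_mem_imaginaryUnits hI) z) := by
  have hO := hD.1.isDomainSet.1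
  obtain ⟨r, hr⟩ := hD.1.meets_real
  have real : ∀ (K : ℍ[ℝ]) (hK : K ∈ imaginaryUnits) (t : ℝ), sliceHom K hK t = (t : ℍ[ℝ]) := by
    intro K hK t
    simp
  refine SliceDiffAt.eqOn_of_real (hJ := hJ) (isOpen_slice hJ hO) (isPreconnected_slice hD.1 hJ)
    (r := r) (by simpa [real] using hr)
    (u := fun z => (2 : ℍ[ℝ]) * f (sliceHom J hJ z))
    (v := fun z => (1 - J * I) * f (sliceHom I hI z)
      + (1 + J * I) * f (sliceHom (-I) (neg_mem_imaginaryUnits hI) z)) ?_ ?_ ?_ hz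
  · intro w hw
    exact (hf.sliceDiffAt hO hJ hw).intertwine (by rw [mul_two, two_mul])
  · intro w hw
    -- J(1 - JI) = J + I = (1 - JI)I and J(1 + JI) = J - I = (1 + JI)(-I).
    refine ((hf.sliceDiffAt hO hI (hD.2.sliceHom_mem hI hw)).intertwine ?_).add
      ((hf.sliceDiffAt hO (neg_mem_imaginaryUnits hI) (hD.2.sliceHom_mem _ hw)).intertwine ?_)
    · rw [mul_sub, sub_mul, ← mul_assoc, mul_assoc J I I, mul_self_of_mem hI, mul_self_of_mem hJ]
      simp [add_comm]
    · rw [mul_add, add_mul, ← mul_assoc, mul_neg, mul_neg, mul_assoc J I I, mul_self_of_mem hI,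
        mul_self_of_mem hJ]
      simp [add_comm]
  · intro t _
    simp only [real]
    rw [← add_mul]
    congr 1
    rw [← one_add_one_eq_two]; abel

/-! ### The *-powers on the line through their centre -/

theorem evalRight_add (P Q : Polynomial ℍ[ℝ]) (q : ℍ[ℝ]) :
    evalRight (P + Q) q = evalRight P q + evalRight Q q :=
  Polynomial.sum_add_index _ _ _ (by simp) (by simp [mul_add])

theorem evalRight_monomial (n : ℕ) (a q : ℍ[ℝ]) :
    evalRight (Polynomial.monomial n a) q = q ^ n * a :=
  Polynomial.sum_monomial_index _ _ (by simp)

theorem regConj_add (P Q : Polynomial ℍ[ℝ]) : regConj (P + Q) = regConj P + regConj Q :=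
  Polynomial.sum_add_index _ _ _ (by simp) (by simp)

theorem regConj_monomial (n : ℕ) (a : ℍ[ℝ]) :
    regConj (Polynomial.monomial n a) = Polynomial.monomial n (star a) :=
  Polynomial.sum_monomial_index _ _ (by simp)

theorem evalRight_map {I : ℍ[ℝ]} (hI : I ∈ imaginaryUnits) (P : Polynomial ℂ) (z : ℂ) :
    evalRight (P.map (sliceHom I hI).toRingHom) (sliceHom I hI z)
      = sliceHom I hI (P.eval z) := by
  induction P using Polynomial.induction_on' with
  | add p q hp hq => rw [Polynomial.map_add, evalRight_add, hp, hq, Polynomial.eval_add, map_add]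
  | monomial n a =>
    rw [Polynomial.map_monomial, evalRight_monomial, Polynomial.eval_monomial, mul_comm a, map_mul,
      map_pow]
    rfl

theorem regConj_map {I : ℍ[ℝ]} (hI : I ∈ imaginaryUnits) (P : Polynomial ℂ) :
    regConj (P.map (sliceHom I hI).toRingHom)
      = (P.map (starRingEnd ℂ)).map (sliceHom I hI).toRingHom := by
  induction P using Polynomial.induction_on' with
  | add p q hp hq => simp only [Polynomial.map_add, regConj_add, hp, hq]
  | monomial n a =>
    rw [Polynomial.map_monomial, regConj_monomial, Polynomial.map_monomial, Polynomial.map_monomial]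
    congr 1
    exact star_sliceHom hI a

theorem sliceHom_inv {I : ℍ[ℝ]} (hI : I ∈ imaginaryUnits) (z : ℂ) :
    sliceHom I hI z⁻¹ = (sliceHom I hI z)⁻¹ := map_inv₀ _ _

theorem X_sub_C_pow_eq_map {I : ℍ[ℝ]} (hI : I ∈ imaginaryUnits) (p : ℂ) (n : ℕ) :
    (Polynomial.X - Polynomial.C (sliceHom I hI p)) ^ n
      = ((Polynomial.X - Polynomial.C p) ^ n).map (sliceHom I hI).toRingHom := by
  simp

theorem starPow_natCast {I : ℍ[ℝ]} (hI : I ∈ imaginaryUnits) (p z : ℂ) (n : ℕ) :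
    starPow (sliceHom I hI p) n (sliceHom I hI z) = sliceHom I hI ((z - p) ^ n) := by
  change evalRight _ _ = _
  rw [X_sub_C_pow_eq_map, evalRight_map]
  simp

/-- On the line of p everything commutes, and for negative n the factor (z - p̄) to the power -n
cancels from the reciprocal. At z = p̄ the symmetrization vanishes and its inverse is the default 0,
hence the hypothesis. -/
theorem starPow_sliceHom {I : ℍ[ℝ]} (hI : I ∈ imaginaryUnits) {p z : ℂ}
    (hz : z ≠ star p) (n : ℤ) :
    starPow (sliceHom I hI p) n (sliceHom I hI z) = sliceHom I hI ((z - p) ^ n) := by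
  cases n with
  | ofNat n => simpa using starPow_natCast hI p z n
  | negSucc n =>
    have h : (z - star p) ^ (n + 1) ≠ 0 := pow_ne_zero _ (sub_ne_zero.2 hz)
    change (evalRight (_ * _) _)⁻¹ * evalRight _ _ = _
    rw [X_sub_C_pow_eq_map, regConj_map, ← Polynomial.map_mul, evalRight_map, evalRight_map,
      ← sliceHom_inv, ← map_mul]
    congr 1
    simp only [Polynomial.eval_mul, Polynomial.eval_pow, Polynomial.map_pow, Polynomial.map_sub,
      Polynomial.map_X, Polynomial.map_C, Polynomial.eval_sub, Polynomial.eval_X, Polynomial.eval_C,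
      starRingEnd_apply, mul_inv, zpow_negSucc]
    rw [mul_assoc, inv_mul_cancel₀ h, mul_one]

theorem hasSum_of_forall_eq {ι : Type*} {u v : ι → ℍ[ℝ]} {a : ℍ[ℝ]} (h : ∀ k, v k = u k)
    (hu : HasSum u a) : HasSum v a := by
  rwa [funext h]

/-! ### Small annuli around non-real points -/

theorem onSameLine_sliceHom {J : ℍ[ℝ]} (hJ : J ∈ imaginaryUnits) (z w : ℂ) :
    OnSameLine (sliceHom J hJ z) (sliceHom J hJ w) :=
  ⟨J, hJ, complexLine_eq_range hJ ▸ ⟨z, rfl⟩, complexLine_eq_range hJ ▸ ⟨w, rfl⟩⟩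

theorem sliceHom_mem_sigmaAnnulus {J : ℍ[ℝ]} (hJ : J ∈ imaginaryUnits) {z w : ℂ} {R : ℝ}
    (h : z ≠ w) (hR : ‖z - w‖ < R) : sliceHom J hJ z ∈ sigmaAnnulus (sliceHom J hJ w) 0 R := by
  have hn : ‖sliceHom J hJ z - sliceHom J hJ w‖ = ‖z - w‖ := by rw [← map_sub, norm_sliceHom]
  refine ⟨?_, ?_⟩
  · rw [tauDist, if_pos (onSameLine_sliceHom hJ z w), hn]
    exact norm_pos_iff.2 (sub_ne_zero.2 h)
  · rw [sigmaDist, if_pos (onSameLine_sliceHom hJ z w), hn]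
    exact hR

/-- Small annuli centred at a non-real point are punctured discs of a complex line. -/
theorem exists_of_mem_sigmaAnnulus {J : ℍ[ℝ]} (hJ : J ∈ imaginaryUnits) {w : ℂ} {R : ℝ}
    (hw : w.im ≠ 0) (hR : R ≤ |w.im|) {q : ℍ[ℝ]} (hq : q ∈ sigmaAnnulus (sliceHom J hJ w) 0 R) :
    ∃ z, z ≠ w ∧ ‖z - w‖ < R ∧ sliceHom J hJ z = q := by
  have him : ‖(sliceHom J hJ w).im‖ = |w.im| := by
    rw [sliceHom_apply, im_slicePoint hJ, norm_mul, norm_of_mem hJ, mul_one, Quaternion.norm_coe,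
      Real.norm_eq_abs]
  by_cases hs : OnSameLine q (sliceHom J hJ w)
  · obtain ⟨h1, h2⟩ := hq
    rw [tauDist, if_pos hs] at h1
    rw [sigmaDist, if_pos hs] at h2
    obtain ⟨K, hK, ⟨x, y, rfl⟩, ⟨x', y', hp⟩⟩ := hs
    -- The centre is not real, so it lies on only one complex line: K is a real multiple of J.
    have hi : (w.im : ℍ[ℝ]) * J = (y' : ℍ[ℝ]) * K := by
      rw [← im_slicePoint hJ w.re, ← im_slicePoint hK x', ← hp, sliceHom_apply]
    have hy' : y' ≠ 0 := by
      rintro rfl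
      rw [sliceHom_apply] at him
      rw [im_slicePoint hJ, hi] at him
      simp at him
      exact hw (abs_eq_zero.1 him.symm)
    have hKJ : K = ((w.im / y' : ℝ) : ℍ[ℝ]) * J := by
      rw [div_eq_inv_mul, Quaternion.coe_mul, mul_assoc, hi, ← mul_assoc, ← Quaternion.coe_mul,
        inv_mul_cancel₀ hy', Quaternion.coe_one, one_mul]
    have hz : sliceHom J hJ ⟨x, y * (w.im / y')⟩ = slicePoint K x y := by
      rw [sliceHom_apply, slicePoint, slicePoint]
      conv_rhs => rw [hKJ]
      rw [Quaternion.coe_mul, mul_assoc]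
    refine ⟨_, ?_, ?_, hz⟩
    · intro h
      rw [← hz, h, sub_self, norm_zero] at h1
      exact lt_irrefl _ h1
    · rwa [← norm_sliceHom hJ, map_sub, hz]
  · exfalso
    have h2 := hq.2
    rw [sigmaDist, if_neg hs, him] at h2
    -- Off the line of the centre, σ is at least |Im w| ≥ R.
    have : |w.im| ≤ Real.sqrt ((q.re - (sliceHom J hJ w).re) ^ 2 + (‖q.im‖ + |w.im|) ^ 2) :=
      Real.le_sqrt_of_sq_le (by
        nlinarith [sq_nonneg (q.re - (sliceHom J hJ w).re), norm_nonneg q.im, abs_nonneg w.im])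
    linarith

theorem sigmaAnnulus_mono (p : ℍ[ℝ]) {R R' : ℝ} (h : R ≤ R') :
    sigmaAnnulus p 0 R ⊆ sigmaAnnulus p 0 R' := fun _ hq => ⟨hq.1, hq.2.trans_le h⟩

theorem ne_star_of_norm_sub_lt {z w : ℂ} (hw : w.im ≠ 0) (h : ‖z - w‖ < |w.im|) : z ≠ star w := by
  rintro rfl
  have h1 := Complex.abs_im_le_norm (star w - w)
  have h2 : (star w - w).im = -(2 * w.im) := by simp; ring
  rw [h2, abs_neg, abs_mul, abs_two] at h1
  linarith [abs_pos.2 hw]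

/-! ### Pole order as growth along a complex line -/

/-- `|z - w|ᵐ f` is bounded near `w` on the complex line `ℝ + J ℝ`. -/
def WeightBounded (f : ℍ[ℝ] → ℍ[ℝ]) (J : ℍ[ℝ]) (hJ : J ∈ imaginaryUnits) (w : ℂ) (m : ℕ) : Prop :=
  ∃ C : ℝ, ∀ᶠ z in 𝓝[≠] w, ‖z - w‖ ^ m * ‖f (sliceHom J hJ z)‖ ≤ C

theorem weightBounded_of_mem_poleBounds {f : ℍ[ℝ] → ℍ[ℝ]} {D : Set ℍ[ℝ]} {J : ℍ[ℝ]}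
    {hJ : J ∈ imaginaryUnits} {w : ℂ} (hw : w.im ≠ 0) {m : ℕ}
    (hm : m ∈ poleBounds f D (sliceHom J hJ w)) : WeightBounded f J hJ w m := by
  let _ := sliceNormedSpace J hJ
  obtain ⟨a, ⟨R, hR, -, hs⟩, ha⟩ := hm
  have hsum : ∀ z, z ≠ w → ‖z - w‖ < R → ‖z - w‖ < |w.im| →
      HasSum (fun k : ℕ => (z - w) ^ k • a (k - m)) ((z - w) ^ m • f (sliceHom J hJ z)) := by
    intro z hzw hzR hzi
    have hz : z ≠ star w := ne_star_of_norm_sub_lt hw (by linarith)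
    have h1 := hs _ (sliceHom_mem_sigmaAnnulus hJ hzw hzR)
    have h2 : HasSum (fun n : ℤ => (z - w) ^ n • a n) (f (sliceHom J hJ z)) := by
      convert h1 using 2 with n
      rw [starPow_sliceHom hJ hz]
      rfl
    have h3 := h2.const_smul ((z - w) ^ m)
    have hinj : Function.Injective (fun k : ℕ => (k : ℤ) - m) := fun i j h => by simpa using h
    have h4 := (hinj.hasSum_iff ?_).2 h3
    · convert h4 using 2 with k
      have hne : z - w ≠ 0 := sub_ne_zero.2 hzw
      simp only [Function.comp, smul_smul]
      rw [zpow_sub₀ hne, zpow_natCast, zpow_natCast, mul_div_cancel₀ _ (pow_ne_zero _ hne)]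
    -- Exponents outside the range of k ↦ k - m lie below -m, where the coefficients vanish.
    · intro n hn
      have : ∃ k : ℕ, m < k ∧ n = -k := by
        refine ⟨(-n).toNat, ?_, ?_⟩ <;>
        · by_contra hc
          exact hn ⟨(n + m).toNat, by change ((n + m).toNat : ℤ) - m = n; omega⟩
      obtain ⟨k, hk, rfl⟩ := this
      rw [ha k hk, smul_zero, smul_zero]
  obtain ⟨r, hr, hrR, hri⟩ : ∃ r : ℝ, 0 < r ∧ r < R ∧ r < |w.im| := by
    have := abs_pos.2 hw
    exact ⟨min R |w.im| / 2, by positivity, by linarith [min_le_left R |w.im|, lt_min hR this],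
      by linarith [min_le_right R |w.im|, lt_min hR this]⟩
  have hn : ‖w + r - w‖ = r := by simp [abs_of_pos hr]
  -- Convergence at one point at distance r bounds the terms there by some M; on the disc of radius
  -- r/2 the series is then dominated by ∑ M/2^k = 2M.
  have hb := hsum (w + r) (by simpa using hr.ne') (by rwa [hn]) (by rwa [hn])
  obtain ⟨M, hM⟩ := hb.summable.tendsto_atTop_zero.norm.bddAbove_range
  refine ⟨2 * M, ?_⟩
  have hball : Metric.ball w (r / 2) ∈ 𝓝[≠] w :=
    nhdsWithin_le_nhds (Metric.ball_mem_nhds w (by positivity))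
  filter_upwards [hball, self_mem_nhdsWithin] with z hz hzw
  rw [Metric.mem_ball, dist_eq_norm] at hz
  have := hsum z hzw (by linarith) (by linarith)
  rw [← norm_pow, ← norm_smul]
  have hg : HasSum (fun k : ℕ => M * (1 / 2) ^ k) (M * 2) := hasSum_geometric_two.mul_left M
  rw [mul_comm]
  refine this.norm_le_of_bounded hg fun k => ?_
  have hk : r ^ k * ‖a (k - m)‖ ≤ M := by
    have := hM ⟨k, rfl⟩
    simpa [norm_smul, hn, abs_of_pos hr] using this
  rw [norm_smul, norm_pow]
  calc ‖z - w‖ ^ k * ‖a (k - m)‖ ≤ (r / 2) ^ k * ‖a (k - m)‖ := by gcongr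
    _ = r ^ k * ‖a (k - m)‖ * (1 / 2) ^ k := by rw [div_pow, one_div, inv_pow]; ring
    _ ≤ M * (1 / 2) ^ k := by gcongr

theorem exists_hasSum_of_sliceDiffAt {J : ℍ[ℝ]} (hJ : J ∈ imaginaryUnits) {u : ℂ → ℍ[ℝ]} {w : ℂ}
    {R : ℝ} (hR : 0 < R) (hu : ∀ z, ‖z - w‖ < R → SliceDiffAt J hJ u z) :
    ∃ c : ℕ → ℍ[ℝ], ∀ z, ‖z - w‖ < R / 2 →
      HasSum (fun k => sliceHom J hJ ((z - w) ^ k) * c k) (u z) := by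
  let _ := sliceNormedSpace J hJ
  have hd : DifferentiableOn ℂ u (Metric.closedBall w (R / 2).toNNReal) := by
    intro z hz
    refine ((sliceDiffAt_iff hJ u z).1 (hu z ?_)).differentiableWithinAt
    rw [Real.coe_toNNReal _ (by positivity), Metric.mem_closedBall, dist_eq_norm] at hz
    linarith
  have hp := hd.hasFPowerSeriesOnBall (Real.toNNReal_pos.2 (by positivity))
  refine ⟨fun k => (cauchyPowerSeries u w (R / 2).toNNReal).coeff k, fun z hz => ?_⟩
  have hmem : z - w ∈ Metric.eball (0 : ℂ) ((R / 2).toNNReal : ENNReal) := by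
    rw [Metric.eball_coe, Real.coe_toNNReal _ (by positivity)]
    simpa using hz
  have := hp.hasSum hmem
  rw [add_sub_cancel] at this
  simp only [FormalMultilinearSeries.apply_eq_pow_smul_coeff] at this
  exact this

/-- The expansion of a holomorphic function on a punctured disc where it is bounded. -/
theorem exists_hasSum_of_bounded {J : ℍ[ℝ]} (hJ : J ∈ imaginaryUnits) {u : ℂ → ℍ[ℝ]} {w : ℂ} {R : ℝ}
    (hR : 0 < R) (hu : ∀ z, z ≠ w → ‖z - w‖ < R → SliceDiffAt J hJ u z)
    {C : ℝ} (hC : ∀ᶠ z in 𝓝[≠] w, ‖u z‖ ≤ C) :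
    ∃ c : ℕ → ℍ[ℝ], ∀ z, z ≠ w → ‖z - w‖ < R / 2 →
      HasSum (fun k => sliceHom J hJ ((z - w) ^ k) * c k) (u z) := by
  let _ := sliceNormedSpace J hJ
  have hd : DifferentiableOn ℂ (Function.update u w (limUnder (𝓝[≠] w) u)) (Metric.ball w R) := by
    refine Complex.differentiableOn_update_limUnder_of_isLittleO (Metric.ball_mem_nhds w hR) ?_ ?_
    · intro z hz
      refine ((sliceDiffAt_iff hJ u z).1 (hu z hz.2 ?_)).differentiableWithinAt
      rw [← dist_eq_norm]
      exact hz.1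
    -- A bounded function is o(1/(z - w)), as Riemann's theorem requires.
    · refine IsBoundedUnder.isLittleO_sub_self_inv ⟨C + ‖u w‖, eventually_map.2 ?_⟩
      filter_upwards [hC] with z hz
      exact (norm_sub_le _ _).trans (by gcongr)
  obtain ⟨c, hc⟩ := exists_hasSum_of_sliceDiffAt hJ hR fun z hz =>
    (sliceDiffAt_iff hJ _ z).2 (hd.differentiableAt (Metric.isOpen_ball.mem_nhds (by
      rwa [Metric.mem_ball, dist_eq_norm])))
  refine ⟨c, fun z hzw hz => ?_⟩
  have := hc z hz
  rwa [Function.update_of_ne hzw] at this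

theorem mem_poleBounds_of_weightBounded {f : ℍ[ℝ] → ℍ[ℝ]} {D : Set ℍ[ℝ]} (hD : IsOpen D)
    (hf : IsSliceRegularOn f D) {J : ℍ[ℝ]} {hJ : J ∈ imaginaryUnits} {w : ℂ} (hw : w.im ≠ 0)
    (hs : IsSingularity D (sliceHom J hJ w)) {m : ℕ} (hm : WeightBounded f J hJ w m) :
    m ∈ poleBounds f D (sliceHom J hJ w) := by
  obtain ⟨R₀, hR₀, hsub₀⟩ := hs
  obtain ⟨R, hR, hRR, hRi⟩ : ∃ R : ℝ, 0 < R ∧ R ≤ R₀ ∧ R ≤ |w.im| :=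
    ⟨min R₀ |w.im|, lt_min hR₀ (abs_pos.2 hw), min_le_left _ _, min_le_right _ _⟩
  have hsub := (sigmaAnnulus_mono (sliceHom J hJ w) hRR).trans hsub₀
  obtain ⟨C, hC⟩ := hm
  obtain ⟨c, hc⟩ := exists_hasSum_of_bounded hJ (u := fun z => sliceHom J hJ ((z - w) ^ m) *
    f (sliceHom J hJ z)) (w := w) hR (by
      intro z hz hzR
      have h1 := hf.sliceDiffAt hD hJ (hsub (sliceHom_mem_sigmaAnnulus hJ hz hzR))
      let _ := sliceNormedSpace J hJ
      rw [sliceDiffAt_iff] at h1 ⊢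
      have h2 : DifferentiableAt ℂ (fun z => (z - w) ^ m) z := by fun_prop
      exact h2.smul h1) (C := C) (by
      filter_upwards [hC] with z hz
      rwa [norm_mul, norm_sliceHom, norm_pow])
  -- Dividing the expansion of (z - w)^m f by (z - w)^m shifts the indices by m.
  refine ⟨fun n => if 0 ≤ n + m then c (n + m).toNat else 0, ⟨R / 2, by positivity,
    (sigmaAnnulus_mono _ (by linarith)).trans hsub, ?_⟩, ?_⟩
  · intro q hq
    obtain ⟨z, hzw, hzR, rfl⟩ := exists_of_mem_sigmaAnnulus hJ hw (by linarith) hq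
    have hz : z ≠ star w := ne_star_of_norm_sub_lt hw (by linarith)
    have hne : z - w ≠ 0 := sub_ne_zero.2 hzw
    have h1 := (hc z hzw hzR).mul_left (sliceHom J hJ ((z - w) ^ m)⁻¹)
    rw [← mul_assoc, ← map_mul, inv_mul_cancel₀ (pow_ne_zero _ hne), map_one, one_mul] at h1
    have hinj : Function.Injective (fun k : ℕ => (k : ℤ) - m) := fun i j h => by simpa using h
    refine (hinj.hasSum_iff ?_).1 ?_
    · intro n hn
      have : ¬ 0 ≤ n + m := fun h =>
        hn ⟨(n + m).toNat, by change ((n + m).toNat : ℤ) - m = n; omega⟩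
      simp [this]
    · refine hasSum_of_forall_eq (fun k => ?_) h1
      simp only [Function.comp, sub_add_cancel, Nat.cast_nonneg, if_true, Int.toNat_natCast]
      rw [starPow_sliceHom hJ hz, ← mul_assoc, ← map_mul, zpow_sub₀ hne, zpow_natCast, zpow_natCast,
        div_eq_inv_mul]
  · intro k hk
    exact if_neg (by omega)

/-! ### Power series at real points -/

theorem imaginaryUnits_nonempty : imaginaryUnits.Nonempty := by
  obtain ⟨i, h0, h1, h2, h3⟩ : ∃ i : ℍ[ℝ], i.re = 0 ∧ i.imI = 1 ∧ i.imJ = 0 ∧ i.imK = 0 :=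
    ⟨⟨0, 1, 0, 0⟩, rfl, rfl, rfl, rfl⟩
  have h : i * i = -1 := by ext <;> simp [h0, h1, h2, h3]
  exact ⟨i, (sq i).trans h⟩

theorem exists_sliceHom_eq (q : ℍ[ℝ]) :
    ∃ (I : ℍ[ℝ]) (hI : I ∈ imaginaryUnits) (z : ℂ), sliceHom I hI z = q := by
  by_cases h : q.im = 0
  · obtain ⟨I, hI⟩ := imaginaryUnits_nonempty
    refine ⟨I, hI, q.re, ?_⟩
    conv_rhs => rw [← Quaternion.re_add_im q, h, add_zero]
    simp
  · have hn : ‖q.im‖ ≠ 0 := norm_ne_zero_iff.2 h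
    have hI : (‖q.im‖⁻¹ : ℝ) • q.im ∈ imaginaryUnits := by
      have h2 : q.im ^ 2 = -((‖q.im‖ * ‖q.im‖ : ℝ) : ℍ[ℝ]) := by
        rw [← Quaternion.normSq_eq_norm_mul_self]
        exact Quaternion.sq_eq_neg_normSq.2 (by simp)
      change _ ^ 2 = _
      rw [smul_pow, h2, smul_neg, ← Quaternion.coe_smul, smul_eq_mul]
      congr 1
      rw [← Quaternion.coe_one]
      congr 1
      field_simp
    refine ⟨_, hI, ⟨q.re, ‖q.im‖⟩, ?_⟩
    rw [sliceHom_apply, slicePoint, Quaternion.coe_mul_eq_smul, smul_smul, mul_inv_cancel₀ hn,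
      one_smul, Quaternion.re_add_im]

theorem eq_of_hasSum_pow_smul {g : ℝ → ℍ[ℝ]} {c d : ℕ → ℍ[ℝ]} {r : ℝ} (hr : 0 < r)
    (hc : ∀ t : ℝ, |t| < r → HasSum (fun k => t ^ k • c k) (g t))
    (hd : ∀ t : ℝ, |t| < r → HasSum (fun k => t ^ k • d k) (g t)) : c = d := by
  have key : ∀ e : ℕ → ℍ[ℝ], (∀ t : ℝ, |t| < r → HasSum (fun k => t ^ k • e k) (g t)) →
      HasFPowerSeriesAt g (show FormalMultilinearSeries ℝ ℝ ℍ[ℝ] from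
        fun k => ContinuousMultilinearMap.mkPiRing ℝ (Fin k) (e k)) 0 := by
    intro e he
    refine hasFPowerSeriesAt_iff.2 ?_
    filter_upwards [Metric.ball_mem_nhds (0 : ℝ) hr] with t ht
    have := he t (by simpa using ht)
    simpa [FormalMultilinearSeries.coeff] using this
  have h := (key c hc).eq_formalMultilinearSeries (key d hd)
  funext k
  have := congrFun h k
  exact ContinuousMultilinearMap.mkPiRing_eq_iff.1 this

/-- A function that is regular near a real point has a power series expansion there. -/
theorem IsSliceRegularOn.exists_hasSum_real {g : ℍ[ℝ] → ℍ[ℝ]} {U : Set ℍ[ℝ]} (hU : IsOpen U)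
    (hg : IsSliceRegularOn g U) {x R : ℝ} (hR : 0 < R) (hb : Metric.ball (x : ℍ[ℝ]) R ⊆ U) :
    ∃ a : ℕ → ℍ[ℝ], ∀ q : ℍ[ℝ], ‖q - x‖ < R / 2 →
      HasSum (fun k : ℕ => starPow x k q * a k) (g q) := by
  have hx : ∀ (I : ℍ[ℝ]) (hI : I ∈ imaginaryUnits) (t : ℝ), sliceHom I hI t = (t : ℍ[ℝ]) :=
    fun I hI t => by simp
  have hex : ∀ (I : ℍ[ℝ]) (hI : I ∈ imaginaryUnits), ∃ c : ℕ → ℍ[ℝ], ∀ z : ℂ, ‖z - x‖ < R / 2 →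
      HasSum (fun k => sliceHom I hI ((z - x) ^ k) * c k) (g (sliceHom I hI z)) := by
    intro I hI
    refine exists_hasSum_of_sliceDiffAt hI hR fun z hz => hg.sliceDiffAt hU hI (hb ?_)
    rwa [Metric.mem_ball, dist_eq_norm, ← hx I hI, ← map_sub, norm_sliceHom]
  obtain ⟨I, hI⟩ := imaginaryUnits_nonempty
  obtain ⟨a, ha⟩ := hex I hI
  refine ⟨a, fun q hq => ?_⟩
  obtain ⟨J, hJ, z, rfl⟩ := exists_sliceHom_eq q
  obtain ⟨c, hc⟩ := hex J hJ
  -- On the real axis the expansions from all lines represent the same function, so their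
  -- coefficients agree.
  have hreal : ∀ (K : ℍ[ℝ]) (hK : K ∈ imaginaryUnits) (e : ℕ → ℍ[ℝ]),
      (∀ z : ℂ, ‖z - x‖ < R / 2 →
        HasSum (fun k => sliceHom K hK ((z - x) ^ k) * e k) (g (sliceHom K hK z))) →
      ∀ t : ℝ, |t| < R / 2 → HasSum (fun k => t ^ k • e k) (g ((x + t : ℝ) : ℍ[ℝ])) := by
    intro K hK e he t ht
    have := he ((x + t : ℝ) : ℂ) (by simpa using ht)
    rw [hx] at this
    convert this using 2 with k
    rw [← Complex.ofReal_sub, add_sub_cancel_left, ← Complex.ofReal_pow, hx,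
      Quaternion.coe_mul_eq_smul]
  have hac : a = c := eq_of_hasSum_pow_smul (half_pos hR) (hreal I hI a ha) (hreal J hJ c hc)
  rw [← hx J hJ, ← map_sub, norm_sliceHom] at hq
  subst hac
  convert hc z hq using 2 with k
  rw [← starPow_natCast, hx]

theorem onSameLine_coe (q : ℍ[ℝ]) (x : ℝ) : OnSameLine q x := by
  obtain ⟨I, hI, z, rfl⟩ := exists_sliceHom_eq q
  simpa using onSameLine_sliceHom hI z x

/-- A function with a regular extension near a real point has a pole (of order `0`) there. -/
theorem isPole_of_regular_real {f g : ℍ[ℝ] → ℍ[ℝ]} {D U : Set ℍ[ℝ]} (hU : IsOpen U)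
    (hg : IsSliceRegularOn g U) {x : ℝ} (hx : (x : ℍ[ℝ]) ∈ U) (hgf : Set.EqOn g f (U ∩ D))
    (hs : IsSingularity D x) : IsPole f D x := by
  obtain ⟨R, hR, hb⟩ := Metric.isOpen_iff.1 hU x hx
  obtain ⟨R', hR', hsub⟩ := hs
  obtain ⟨a, ha⟩ := hg.exists_hasSum_real hU hR hb
  have hsub' := (sigmaAnnulus_mono (x : ℍ[ℝ]) (min_le_right (R / 2) R')).trans hsub
  refine ⟨0, fun n => if 0 ≤ n then a n.toNat else 0,
    ⟨min (R / 2) R', lt_min (half_pos hR) hR', hsub', ?_⟩, fun k hk => if_neg (by omega)⟩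
  intro q hq
  have hqn : ‖q - x‖ < R / 2 := by
    have := hq.2
    rw [sigmaDist, if_pos (onSameLine_coe q x)] at this
    exact this.trans_le (min_le_left _ _)
  have hqU : q ∈ U := hb (by rw [Metric.mem_ball, dist_eq_norm]; linarith)
  rw [← hgf ⟨hqU, hsub' hq⟩]
  have hinj : Function.Injective fun k : ℕ => (k : ℤ) := Nat.cast_injective
  refine (hinj.hasSum_iff ?_).1 ?_
  · intro n hn
    have : ¬ 0 ≤ n := fun h => hn ⟨n.toNat, Int.toNat_of_nonneg h⟩
    simp [this]
  · refine hasSum_of_forall_eq (fun k => ?_) (ha q hqn)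
    simp [Function.comp]

/-! ### Growth near regular points and along a sphere -/

theorem IsPole.isSingularity {f : ℍ[ℝ] → ℍ[ℝ]} {D : Set ℍ[ℝ]} {p : ℍ[ℝ]} (h : IsPole f D p) :
    IsSingularity D p := by
  obtain ⟨m, a, ⟨R, hR, hs, -⟩, -⟩ := h
  exact ⟨R, hR, hs⟩

theorem isSingularity_of_mem_of_real {D : Set ℍ[ℝ]} (hD : IsOpen D) {x : ℝ}
    (hx : (x : ℍ[ℝ]) ∈ D) : IsSingularity D x := by
  obtain ⟨R, hR, hb⟩ := Metric.isOpen_iff.1 hD x hx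
  refine ⟨R, hR, fun q hq => hb ?_⟩
  have := hq.2
  rwa [sigmaDist, if_pos (onSameLine_coe q x), ← dist_eq_norm] at this

theorem isSingularity_of_mem {D : Set ℍ[ℝ]} (hD : IsOpen D) {J : ℍ[ℝ]} {hJ : J ∈ imaginaryUnits}
    {w : ℂ} (hw : w.im ≠ 0) (h : sliceHom J hJ w ∈ D) : IsSingularity D (sliceHom J hJ w) := by
  obtain ⟨R, hR, hb⟩ := Metric.isOpen_iff.1 hD _ h
  refine ⟨min R |w.im|, lt_min hR (abs_pos.2 hw), fun q hq => ?_⟩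
  obtain ⟨z, -, hz, rfl⟩ := exists_of_mem_sigmaAnnulus hJ hw (min_le_right _ _) hq
  refine hb ?_
  rw [Metric.mem_ball, dist_eq_norm, ← map_sub, norm_sliceHom]
  exact hz.trans_le (min_le_left _ _)

/-- The extension g is continuous along the line, hence bounded near w; U need not be symmetric. -/
theorem weightBounded_zero_of_regular {f g : ℍ[ℝ] → ℍ[ℝ]} {D U : Set ℍ[ℝ]} (hU : IsOpen U)
    (hg : IsSliceRegularOn g U) {J : ℍ[ℝ]} {hJ : J ∈ imaginaryUnits} {w : ℂ}
    (hw : sliceHom J hJ w ∈ U) (hgf : Set.EqOn g f (U ∩ D))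
    (hs : IsSingularity D (sliceHom J hJ w)) : WeightBounded f J hJ w 0 := by
  obtain ⟨R, hR, hsub⟩ := hs
  have hc : ContinuousAt (fun z => g (sliceHom J hJ z)) w := by
    have h1 := hg.sliceDiffAt hU hJ hw
    let _ := sliceNormedSpace J hJ
    exact ((sliceDiffAt_iff hJ _ _).1 h1).continuousAt
  refine ⟨‖g (sliceHom J hJ w)‖ + 1, ?_⟩
  have h1 : ∀ᶠ z in 𝓝[≠] w, ‖g (sliceHom J hJ z)‖ < ‖g (sliceHom J hJ w)‖ + 1 :=
    (hc.norm.eventually_lt_const (lt_add_one _)).filter_mono nhdsWithin_le_nhds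
  have h2 : Metric.ball w R ∈ 𝓝[≠] w := nhdsWithin_le_nhds (Metric.ball_mem_nhds w hR)
  have h3 : {z | sliceHom J hJ z ∈ U} ∈ 𝓝[≠] w :=
    nhdsWithin_le_nhds ((isOpen_slice hJ hU).mem_nhds hw)
  filter_upwards [h1, h2, h3, self_mem_nhdsWithin] with z hz1 hz2 hz3 hz4
  rw [pow_zero, one_mul, ← hgf ⟨hz3, hsub (sliceHom_mem_sigmaAnnulus hJ hz4 (by
    rwa [← dist_eq_norm]))⟩]
  exact hz1.le

/-- Along a sphere, the weighted bounds at two distinct points propagate to the whole sphere. -/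
theorem WeightBounded.of_two {f : ℍ[ℝ] → ℍ[ℝ]} {D : Set ℍ[ℝ]} (hD : IsSymmetricSliceDomain D)
    (hf : IsSliceRegularOn f D) {J K L : ℍ[ℝ]} {hJ : J ∈ imaginaryUnits} {hK : K ∈ imaginaryUnits}
    (hL : L ∈ imaginaryUnits) (hJK : J ≠ K) {w : ℂ} (hs : IsSingularity D (sliceHom J hJ w)) {m : ℕ}
    (h1 : WeightBounded f J hJ w m) (h2 : WeightBounded f K hK w m) : WeightBounded f L hL w m := by
  obtain ⟨R, hR, hsub⟩ := hs
  obtain ⟨C, hC⟩ := h1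
  obtain ⟨C', hC'⟩ := h2
  set s := (L - J) * (K - J)⁻¹ with hsdef
  refine ⟨(1 + ‖s‖) * C + ‖s‖ * C', ?_⟩
  have hb : Metric.ball w R ∈ 𝓝[≠] w := nhdsWithin_le_nhds (Metric.ball_mem_nhds w hR)
  filter_upwards [hC, hC', hb, self_mem_nhdsWithin] with z hz hz' hzb hzw
  have hzD : sliceHom J hJ z ∈ D :=
    hsub (sliceHom_mem_sigmaAnnulus hJ hzw (by rwa [← dist_eq_norm]))
  have hN := neg_mem_imaginaryUnits hJ
  set p := f (sliceHom J hJ z) with hp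
  set b := f (sliceHom (-J) hN z) with hb
  have h20 : (2 : ℍ[ℝ]) ≠ 0 := fun h => by
    rw [← one_add_one_eq_two] at h
    have h' : (1 : ℝ) + 1 = 0 := congrArg (fun q : ℍ[ℝ] => q.re) h
    norm_num at h'
  obtain ⟨v, hv⟩ : ∃ v, 2 * v = J * (b - p) := ⟨2⁻¹ * (J * (b - p)), by
    rw [← mul_assoc, mul_inv_cancel₀ h20, one_mul]⟩
  -- The representation formula, rewritten to show that f(x + yM) is affine in M with slope v.
  have r1 : ∀ (M : ℍ[ℝ]) (hM : M ∈ imaginaryUnits),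
      f (sliceHom M hM z) = p + (M - J) * v := by
    intro M hM
    have h := hf.representation hD hJ hM (hD.2.sliceHom_mem hM hzD)
    rw [← hp, ← hb] at h
    refine mul_left_cancel₀ h20 ?_
    have h2 : 2 * ((M - J) * v) = (M - J) * (J * (b - p)) := by
      rw [← hv, two_mul, two_mul, mul_add]
    rw [h, mul_add, h2, ← mul_assoc, sub_mul M J J, mul_self_of_mem hJ]
    noncomm_ring
  have hKJ : K - J ≠ 0 := sub_ne_zero.2 hJK.symm
  -- The value at K gives v = (K - J)⁻¹(f(x + yK) - p), which is substituted at L.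
  have hLs : f (sliceHom L hL z) = p + s * (f (sliceHom K hK z) - p) := by
    rw [r1 L hL, r1 K hK, add_sub_cancel_left, hsdef, mul_assoc, ← mul_assoc _ (K - J),
      inv_mul_cancel₀ hKJ, one_mul]
  have hn : ‖f (sliceHom L hL z)‖ ≤ ‖p‖ + ‖s‖ * (‖f (sliceHom K hK z)‖ + ‖p‖) := by
    rw [hLs]
    refine (norm_add_le _ _).trans ?_
    rw [norm_mul]
    gcongr
    exact norm_sub_le _ _
  calc ‖z - w‖ ^ m * ‖f (sliceHom L hL z)‖
      ≤ ‖z - w‖ ^ m * (‖p‖ + ‖s‖ * (‖f (sliceHom K hK z)‖ + ‖p‖)) := by gcongr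
    _ = (1 + ‖s‖) * (‖z - w‖ ^ m * ‖p‖) + ‖s‖ * (‖z - w‖ ^ m * ‖f (sliceHom K hK z)‖) := by ring
    _ ≤ (1 + ‖s‖) * C + ‖s‖ * C' := by gcongr

/-! ### Comparing orders on a sphere -/

theorem poleBounds_upward {f : ℍ[ℝ] → ℍ[ℝ]} {D : Set ℍ[ℝ]} {p : ℍ[ℝ]} {m n : ℕ}
    (hm : m ∈ poleBounds f D p) (hmn : m ≤ n) : n ∈ poleBounds f D p := by
  obtain ⟨a, h1, h2⟩ := hm
  exact ⟨a, h1, fun k hk => h2 k (hmn.trans_lt hk)⟩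

theorem poleOrder_le_iff {f : ℍ[ℝ] → ℍ[ℝ]} {D : Set ℍ[ℝ]} {p : ℍ[ℝ]}
    (m : ℕ) :
    poleOrder f D p ≤ m ↔ m ∈ poleBounds f D p := by
  refine ⟨fun h => ?_, fun h => iInf₂_le m h⟩
  by_contra hm
  have : ((m + 1 : ℕ) : ℕ∞) ≤ poleOrder f D p := by
    refine le_iInf₂ fun k hk => ?_
    have : ¬ k ≤ m := fun hkm => hm (poleBounds_upward hk hkm)
    exact_mod_cast (by omega : m + 1 ≤ k)
  have h2 := this.trans h
  exact absurd (by exact_mod_cast h2 : m + 1 ≤ m) (by omega)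

theorem IsSemiregular.isPole_real {f : ℍ[ℝ] → ℍ[ℝ]} {D Ω : Set ℍ[ℝ]} (hf : IsSemiregular f D Ω)
    {x : ℝ} (hx : (x : ℍ[ℝ]) ∈ Ω) : IsPole f D x := by
  have hO := hf.domain.1.isDomainSet.1
  by_cases hxD : (x : ℍ[ℝ]) ∈ D
  · exact isPole_of_regular_real hO hf.regular hxD (Set.eqOn_refl f _)
      (isSingularity_of_mem_of_real hO hxD)
  · obtain h | ⟨hs, U, hU, hxU, g, hg, hgf⟩ := hf.pole_or_removable x ⟨hx, hxD⟩
    · exact h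
    · exact isPole_of_regular_real hU hg hxU hgf hs

theorem IsSemiregular.isPole_of_im_ne_zero {f : ℍ[ℝ] → ℍ[ℝ]} {D Ω : Set ℍ[ℝ]}
    (hf : IsSemiregular f D Ω) {J : ℍ[ℝ]} (hJ : J ∈ imaginaryUnits) {w : ℂ} (hw : w.im ≠ 0)
    (hp : sliceHom J hJ w ∈ Ω) : IsPole f D (sliceHom J hJ w) := by
  have hO := hf.domain.1.isDomainSet.1
  by_cases hpD : sliceHom J hJ w ∈ D
  · have hs := isSingularity_of_mem hO hw hpD
    exact ⟨0, mem_poleBounds_of_weightBounded hO hf.regular hw hs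
      (weightBounded_zero_of_regular hO hf.regular hpD (Set.eqOn_refl f _) hs)⟩
  · obtain h | ⟨hs, U, hU, hxU, g, hg, hgf⟩ := hf.pole_or_removable _ ⟨hp, hpD⟩
    · exact h
    · exact ⟨0, mem_poleBounds_of_weightBounded hO hf.regular hw hs
        (weightBounded_zero_of_regular hU hg hxU hgf hs)⟩

/-- Two distinct points of a sphere control the order of the poles on the whole sphere. -/
theorem IsSemiregular.poleOrder_le_of_two {f : ℍ[ℝ] → ℍ[ℝ]} {D Ω : Set ℍ[ℝ]}
    (hf : IsSemiregular f D Ω) {x y : ℝ} (hy : y ≠ 0) (hxy : sphere x y ⊆ Ω) {p q r : ℍ[ℝ]}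
    (hp : p ∈ sphere x y) (hq : q ∈ sphere x y) (hr : r ∈ sphere x y) (hpq : p ≠ q) {m : ℕ}
    (h1 : poleOrder f D p ≤ m) (h2 : poleOrder f D q ≤ m) : poleOrder f D r ≤ m := by
  have hO := hf.domain.1.isDomainSet.1
  have hpole : ∀ (J : ℍ[ℝ]) (hJ : J ∈ imaginaryUnits), IsPole f D (sliceHom J hJ ⟨x, y⟩) :=
    fun J hJ => hf.isPole_of_im_ne_zero hJ hy (hxy ⟨J, hJ, sliceHom_apply hJ _⟩)
  obtain ⟨J, hJ, rfl⟩ := hp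
  obtain ⟨K, hK, rfl⟩ := hq
  obtain ⟨L, hL, rfl⟩ := hr
  have e : ∀ (J : ℍ[ℝ]) (hJ : J ∈ imaginaryUnits), slicePoint J x y = sliceHom J hJ ⟨x, y⟩ :=
    fun J hJ => (sliceHom_apply hJ ⟨x, y⟩).symm
  rw [poleOrder_le_iff, e _ ‹_›] at h1 h2 ⊢
  exact mem_poleBounds_of_weightBounded hO hf.regular hy (hpole L hL).isSingularity
    (WeightBounded.of_two hf.domain hf.regular hL (fun h => hpq (by rw [h]))
      (hpole J hJ).isSingularity
      (weightBounded_of_mem_poleBounds hy h1) (weightBounded_of_mem_poleBounds hy h2))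

theorem IsPole.exists_poleOrder_eq {f : ℍ[ℝ] → ℍ[ℝ]} {D : Set ℍ[ℝ]} {p : ℍ[ℝ]}
    (h : IsPole f D p) : ∃ n : ℕ, poleOrder f D p = n := by
  obtain ⟨m, hm⟩ := h
  have hle : poleOrder f D p ≤ m := iInf₂_le m hm
  exact ENat.ne_top_iff_exists.1 (ne_top_of_le_ne_top (ENat.natCast_ne_top m) hle) |>.imp
    fun _ h => h.symm

theorem sphere_zero (x : ℝ) : sphere x 0 = {(x : ℍ[ℝ])} := by
  obtain ⟨I, hI⟩ := imaginaryUnits_nonempty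
  ext q
  constructor
  · rintro ⟨J, -, rfl⟩
    simp [slicePoint]
  · rintro rfl
    exact ⟨I, hI, by simp [slicePoint]⟩

end SliceRegular

theorem mainTheorem9 (Ω D : Set ℍ[ℝ]) (hΩ : SliceRegular.IsSymmetricSliceDomain Ω)
    (f : ℍ[ℝ] → ℍ[ℝ]) (hf : SliceRegular.IsSemiregular f D Ω)
    (x y : ℝ) (hxy : SliceRegular.sphere x y ⊆ Ω) :
    (∀ p ∈ SliceRegular.sphere x y, SliceRegular.IsPole f D p) ∧
    ∃ n : ℕ,
      (∀ p ∈ SliceRegular.sphere x y, SliceRegular.poleOrder f D p = n) ∨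
      (∃ p₀ ∈ SliceRegular.sphere x y, SliceRegular.poleOrder f D p₀ < n ∧
        ∀ p ∈ SliceRegular.sphere x y, p ≠ p₀ → SliceRegular.poleOrder f D p = n) := by
  rcases eq_or_ne y 0 with rfl | hy
  · rw [SliceRegular.sphere_zero] at hxy ⊢
    have hp := hf.isPole_real (hxy rfl)
    obtain ⟨n, hn⟩ := hp.exists_poleOrder_eq
    refine ⟨?_, n, Or.inl ?_⟩ <;>
    · rintro _ rfl
      assumption
  have hpole : ∀ p ∈ SliceRegular.sphere x y, SliceRegular.IsPole f D p := by
    rintro p ⟨J, hJ, rfl⟩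
    have h := SliceRegular.sliceHom_apply hJ ⟨x, y⟩
    rw [← h]
    exact hf.isPole_of_im_ne_zero hJ hy (hxy ⟨J, hJ, h⟩)
  refine ⟨hpole, ?_⟩
  obtain ⟨I, hI⟩ := SliceRegular.imaginaryUnits_nonempty
  set p₁ := SliceRegular.slicePoint I x y with hp₁
  have h₁ : p₁ ∈ SliceRegular.sphere x y := ⟨I, hI, rfl⟩
  obtain ⟨a, ha⟩ := (hpole p₁ h₁).exists_poleOrder_eq
  by_cases hall : ∀ p ∈ SliceRegular.sphere x y, SliceRegular.poleOrder f D p = a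
  · exact ⟨a, Or.inl hall⟩
  push Not at hall
  obtain ⟨p₂, h₂, hne⟩ := hall
  obtain ⟨b, hb⟩ := (hpole p₂ h₂).exists_poleOrder_eq
  have hab : b ≠ a := fun h => hne (by rw [hb, h])
  have h₁₂ : p₁ ≠ p₂ := fun h => hne (by rw [← h, ha])
  -- Whichever of the two points has the smaller order is the exceptional one.
  have key : ∀ p ∈ SliceRegular.sphere x y, ∀ q ∈ SliceRegular.sphere x y, ∀ k n : ℕ, k < n →
      SliceRegular.poleOrder f D p = k → SliceRegular.poleOrder f D q = n →
      ∃ n : ℕ, ∃ p₀ ∈ SliceRegular.sphere x y, SliceRegular.poleOrder f D p₀ < n ∧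
        ∀ p ∈ SliceRegular.sphere x y, p ≠ p₀ → SliceRegular.poleOrder f D p = n := by
    intro p hp q hq k n hkn hpk hqn
    have hpq : p ≠ q := by
      rintro rfl
      rw [hpk] at hqn
      exact hkn.ne (by exact_mod_cast hqn)
    refine ⟨n, p, hp, by rw [hpk]; exact_mod_cast hkn, fun r hr hrp => ?_⟩
    obtain ⟨c, hc⟩ := (hpole r hr).exists_poleOrder_eq
    have hle := hf.poleOrder_le_of_two hy hxy hp hq hr hpq (m := n)
      (by rw [hpk]; exact_mod_cast hkn.le) hqn.le
    -- If r had order c < n, then p and r would both have order at most max k c < n, forcing the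
    -- same on q, whose order is n.
    have hge := hf.poleOrder_le_of_two hy hxy hp hr hq hrp.symm (m := max k c)
      (by rw [hpk]; exact_mod_cast le_max_left k c) (by rw [hc]; exact_mod_cast le_max_right k c)
    rw [hc] at hle ⊢
    rw [hqn] at hge
    have hle' : c ≤ n := by exact_mod_cast hle
    have hge' : n ≤ max k c := by exact_mod_cast hge
    have : c = n := by omega
    rw [this]
  rcases lt_or_gt_of_ne hab with h | h
  · obtain ⟨n, hn⟩ := key p₂ h₂ p₁ h₁ b a h hb ha
    exact ⟨n, Or.inr hn⟩
  · obtain ⟨n, hn⟩ := key p₁ h₁ p₂ h₂ a b h ha hb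
    exact ⟨n, Or.inr hn⟩
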